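/- **Setting.** For $d\ge 0$ let $Z_d\sim EC_d(0,I)$, i.e. $Z_d$ is a random vector in $\mathbb R^d$ whose law $\nu_d$ has a density $f_d(z)\propto g_d(\|z\|_2^2)$ for some continuous nonnegative function $g_d$ on $[0,\infty)$, and let $(u_d)$ be real constants, depending only on $d$, with $\|Z_d\|_2^2/u_d\to 1$ in probability as $d\to\infty$. For a $p\times p$ correlation matrix $\Sigma$ (positive semidefinite with unit diagonal) of rank $d$, a standard elliptical vector $X\sim EC_p(0,\Sigma)$ is a random vector in $\mathbb R^p$ with the same law as $L^TZ_d$ for some $d\times p$ matrix $L$ with $L^TL=\Sigma$. Write $\|X\|_\infty=\max_{1\le j\le p}|X_j|$. **Theorem.** 1. (ReX bound for degenerate elliptical vectors) For every $\delta>0$, $$\lim_{p,d\to\infty}\mathbb P\left(\frac{\|X\|_\infty}{\sqrt{u_d(1-p^{-2/(d-1)})}}>1+\delta\right)=0,$$ uniformly over all correlation matrices $\Sigma\in\mathbb R^{p\times p}$ of rank $d$ and all $X\sim EC_p(0,\Sigma)$. That is, for all $\delta,\varepsilon>0$ there is $N$ such that the probability is less than $\varepsilon$ for all $p,d\ge N$,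 all such $\Sigma$ and all such $X$. 2. (ReX bound for degenerate Gaussian vectors) For every $\delta>0$, $$\lim_{p,d\to\infty}\mathbb P\left(\frac{\|X\|_\infty}{\sqrt{d(1-p^{-2/(d-1)})}}>1+\delta\right)=0,$$ uniformly over all correlation matrices $\Sigma\in\mathbb R^{p\times p}$ of rank $d$ and $X\sim N_p(0,\Sigma)$. 3. If $d=d(p)$ satisfies $(\log\log p)^2\,d/(\log p)^2\to\infty$ as $p\to\infty$, then $$\lim_{p\to\infty}\mathbb P\left(\frac{\|X\|_\infty}{\sqrt{d(1-p^{-2/(d-1)})}}\le 1\right)=1,$$ uniformly over all correlation matrices $\Sigma\in\mathbb R^{p\times p}$ of rank $d(p)$ and $X\sim N_p(0,\Sigma)$. -/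

import Mathlib

open MeasureTheory ProbabilityTheory Filter Topology Matrix

/-- `ν` is the law of a nondegenerate elliptical vector with location `ξ` and positive definite
scatter matrix `Θ`: a probability measure on `ℝ^p` with Lebesgue density
`f(v) = c * g((v - ξ)ᵀ Θ⁻¹ (v - ξ))` for a continuous nonnegative `g` on `[0, ∞)` and a
normalising constant `c > 0`. (Integrability of `f` is part of `ν` being a probability measure.) -/
def IsEllipticalLaw {p : ℕ} (ξ : EuclideanSpace ℝ (Fin p)) (Θ : Matrix (Fin p) (Fin p) ℝ)
    (ν : Measure (EuclideanSpace ℝ (Fin p))) : Prop :=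
  IsProbabilityMeasure ν ∧ Θ.PosDef ∧
    ∃ g : ℝ → ℝ, ContinuousOn g (Set.Ici 0) ∧ (∀ t, 0 ≤ t → 0 ≤ g t) ∧
      ∃ c : ℝ, 0 < c ∧
        ν = volume.withDensity fun v =>
          ENNReal.ofReal (c * g ((v - ξ).ofLp ⬝ᵥ (Θ⁻¹ *ᵥ (v - ξ).ofLp)))

/-- `S` is a correlation matrix: positive semidefinite with unit diagonal. -/
def IsCorrelationMatrix {p : ℕ} (S : Matrix (Fin p) (Fin p) ℝ) : Prop :=
  S.PosSemidef ∧ ∀ j, S j j = 1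

/-- The (possibly degenerate) centred elliptical vector `X ∼ EC_p(0, S)`, where `S` has rank `d`
and `ν` is the law of the underlying spherical vector `Z ∼ EC_d(0, I)`: `S = Lᵀ L` for some
`d × p` matrix `L`, and `X` has the law of `Lᵀ Z`. -/
def IsEllipticalVector {p d : ℕ} {Ω : Type*} [MeasurableSpace Ω]
    (ν : Measure (EuclideanSpace ℝ (Fin d))) (S : Matrix (Fin p) (Fin p) ℝ)
    (X : Ω → EuclideanSpace ℝ (Fin p)) (P : Measure Ω) : Prop :=
  S.rank = d ∧ ∃ L : Matrix (Fin d) (Fin p) ℝ, Lᵀ * L = S ∧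
    HasLaw X (ν.map fun z => WithLp.toLp 2 (Lᵀ *ᵥ z.ofLp)) P

/-- `‖x‖_∞ = max_j |x_j|`. -/
noncomputable def maxNorm {p : ℕ} (x : EuclideanSpace ℝ (Fin p)) : ℝ := ⨆ j, |x j|

/-- The bound `√(u (1 - p^(-2/(d-1))))`. -/
noncomputable def rexBound (u : ℝ) (p d : ℕ) : ℝ :=
  √(u * (1 - (p : ℝ) ^ (-2 / ((d : ℝ) - 1))))

/-!
The law of a standard Gaussian vector tilted by `exp (-(q - 1) ‖z‖² / 2)` is the law of
`z / √q`. This gives closed forms for the exponential moments of `‖z‖²` and `⟪l, z⟫²`, and Chernoff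
bounds the mass of the cap `{s ‖z‖² < ⟪l, z⟫²}` by `q ^ (-(d - 1) / 2)` up to a constant. All laws
with a radial density give a cone the same mass, so the bound holds for each of them. Writing
`S = (⟪l i, l j⟫)` with unit vectors `l j`, the event that `‖X‖_∞` is large is a union of `p` caps,
once `‖Z‖²` is close to `u`; the value of `q` with `q ^ (-(d - 1) / 2) = 1 / p` is the one in the
`ReX` bound, and the slack `δ` makes the union bound vanish. In the Gaussian high-rank case there is
no slack: tilting on the sets `{b < |⟪l, z⟫|} ∩ {‖z‖² ≤ d (1 + t)}` instead, the Mills ratio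
gains a factor `1 / √(log p)`, which allows `t` of order `log log p / log p`. The norm stays below
that radius as soon as `d t² → ∞`, and this is the growth condition on `d`.
-/

/-! ### Gaussian caps and tails -/

section StdGaussian

open Module Real

variable {E : Type*} [NormedAddCommGroup E] [InnerProductSpace ℝ E] [FiniteDimensional ℝ E]
  [MeasurableSpace E] [BorelSpace E]

theorem integrable_exp_neg_mul_sq_norm {b : ℝ} (hb : 0 < b) :
    Integrable fun v : E => exp (-b * ‖v‖ ^ 2) := by
  refine not_imp_comm.1 integral_undef ?_
  rw [GaussianFourier.integral_rexp_neg_mul_sq_norm hb]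
  positivity

theorem stdGaussian_eq_withDensity : stdGaussian E = volume.withDensity fun v : E =>
    ENNReal.ofReal ((2 * π) ^ (-(finrank ℝ E / 2 : ℝ)) * exp (-(1 / 2) * ‖v‖ ^ 2)) := by
  set c : ℝ := (2 * π) ^ (-(finrank ℝ E / 2 : ℝ)) with hc
  have : IsFiniteMeasure (volume.withDensity fun v : E =>
      ENNReal.ofReal (c * exp (-(1 / 2) * ‖v‖ ^ 2))) :=
    isFiniteMeasure_withDensity_ofReal
      ((integrable_exp_neg_mul_sq_norm (E := E) one_half_pos).const_mul c).2
  refine Measure.ext_of_charFun (funext fun t => ?_)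
  have hfourier : ∫ v : E, Complex.exp (-(1 / 2 : ℂ) * ‖v‖ ^ 2 + Complex.I * inner ℝ t v) =
      ((2 * π) ^ (finrank ℝ E / 2 : ℝ) : ℝ) * Complex.exp (-‖t‖ ^ 2 / 2) := by
    rw [GaussianFourier.integral_cexp_neg_mul_sq_norm_add (by norm_num), Complex.I_sq,
      Complex.ofReal_cpow (by positivity)]
    push_cast
    congr 2 <;> ring_nf
  have hc_mul : (c : ℂ) * ((2 * π) ^ (finrank ℝ E / 2 : ℝ) : ℝ) = 1 := by
    rw [← Complex.ofReal_mul, hc, ← rpow_add (by positivity), neg_add_cancel, rpow_zero,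
      Complex.ofReal_one]
  rw [charFun_stdGaussian, charFun_apply,
    integral_withDensity_eq_integral_toReal_smul (by fun_prop) (by simp)]
  calc Complex.exp (-‖t‖ ^ 2 / 2)
      = c * ∫ v : E, Complex.exp (-(1 / 2 : ℂ) * ‖v‖ ^ 2 + Complex.I * inner ℝ t v) := by
        rw [hfourier, ← mul_assoc, hc_mul, one_mul]
    _ = _ := by
        rw [← integral_const_mul]
        refine integral_congr_ae (.of_forall fun v => ?_)
        dsimp only
        rw [ENNReal.toReal_ofReal (by positivity), Complex.exp_add, real_inner_comm,
          Complex.real_smul, mul_comm Complex.I]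
        push_cast
        ring

theorem integral_stdGaussian {F : Type*} [NormedAddCommGroup F] [NormedSpace ℝ F] (f : E → F) :
    ∫ z, f z ∂(stdGaussian E) =
      (2 * π) ^ (-(finrank ℝ E / 2 : ℝ)) • ∫ v : E, exp (-(1 / 2) * ‖v‖ ^ 2) • f v := by
  rw [stdGaussian_eq_withDensity,
    integral_withDensity_eq_integral_toReal_smul (by fun_prop) (by simp), ← integral_smul]
  refine integral_congr_ae (.of_forall fun v => ?_)
  dsimp only
  rw [ENNReal.toReal_ofReal (by positivity), smul_smul]

theorem integral_exp_mul_sq_norm_smul_stdGaussian {F : Type*} [NormedAddCommGroup F]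
    [NormedSpace ℝ F] {a : ℝ} (ha : a < 1 / 2) (f : E → F) :
    ∫ z, exp (a * ‖z‖ ^ 2) • f (√(1 - 2 * a) • z) ∂(stdGaussian E) =
      (1 - 2 * a) ^ (-(finrank ℝ E / 2 : ℝ)) • ∫ z, f z ∂(stdGaussian E) := by
  have hq : 0 < 1 - 2 * a := by linarith
  have hscale : ((√(1 - 2 * a)) ^ finrank ℝ E)⁻¹ = (1 - 2 * a) ^ (-(finrank ℝ E / 2 : ℝ)) := by
    rw [sqrt_eq_rpow, ← rpow_mul_natCast hq.le, ← rpow_neg hq.le]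
    ring_nf
  have hexp (v : E) : exp (-(1 / 2) * ‖v‖ ^ 2) * exp (a * ‖v‖ ^ 2) =
      exp (-(1 / 2) * ‖√(1 - 2 * a) • v‖ ^ 2) := by
    rw [← exp_add, norm_smul, norm_of_nonneg (sqrt_nonneg _), mul_pow, sq_sqrt hq.le]
    ring_nf
  simp_rw [integral_stdGaussian, smul_smul, hexp]
  rw [Measure.integral_comp_smul_of_nonneg volume
    (fun w : E => exp (-(1 / 2) * ‖w‖ ^ 2) • f w) (√(1 - 2 * a)) (hR := sqrt_nonneg _),
    hscale, smul_smul, mul_comm]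

theorem mgf_sq_norm_stdGaussian {a : ℝ} (ha : a < 1 / 2) :
    mgf (fun z => ‖z‖ ^ 2) (stdGaussian E) a = (1 - 2 * a) ^ (-(finrank ℝ E / 2 : ℝ)) := by
  simpa [mgf] using integral_exp_mul_sq_norm_smul_stdGaussian (E := E) ha fun _ => (1 : ℝ)

theorem integrable_exp_mul_sq_norm_stdGaussian {a : ℝ} (ha : a < 1 / 2) :
    Integrable (fun z => exp (a * ‖z‖ ^ 2)) (stdGaussian E) := by
  refine mgf_pos_iff.1 ?_
  rw [mgf_sq_norm_stdGaussian ha]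
  exact rpow_pos_of_pos (by linarith) _

theorem map_inner_stdGaussian {l : E} (hl : ‖l‖ = 1) :
    (stdGaussian E).map (inner ℝ l) = gaussianReal 0 1 := by
  have h := IsGaussian.map_eq_gaussianReal (μ := stdGaussian E) (innerSL ℝ l)
  rw [integral_strongDual_stdGaussian, variance_dual_stdGaussian] at h
  simpa [hl] using h

theorem stdGaussian_real : stdGaussian ℝ = gaussianReal 0 1 := by
  have hid : (inner ℝ (1 : ℝ) : ℝ → ℝ) = id := by ext; simp
  rw [← map_inner_stdGaussian (norm_one (α := ℝ)), hid, Measure.map_id]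

theorem mgf_sq_gaussianReal {b : ℝ} (hb : b < 1 / 2) :
    mgf (fun y => y ^ 2) (gaussianReal 0 1) b = (1 - 2 * b) ^ (-(1 / 2) : ℝ) := by
  simpa [stdGaussian_real] using mgf_sq_norm_stdGaussian (E := ℝ) hb

theorem mgf_sq_inner_stdGaussian {l : E} (hl : ‖l‖ = 1) {b : ℝ} (hb : b < 1 / 2) :
    mgf (fun z => (inner ℝ l z) ^ 2) (stdGaussian E) b = (1 - 2 * b) ^ (-(1 / 2) : ℝ) := by
  rw [← mgf_sq_gaussianReal hb, ← map_inner_stdGaussian hl,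
    mgf_map (by fun_prop) (by fun_prop)]
  rfl

theorem integral_exp_sq_norm_add_sq_inner_stdGaussian {l : E} (hl : ‖l‖ = 1) {a b : ℝ}
    (ha : a < 1 / 2) (hab : a + b < 1 / 2) :
    ∫ z, exp (a * ‖z‖ ^ 2 + b * (inner ℝ l z) ^ 2) ∂(stdGaussian E) =
      (1 - 2 * a) ^ (-((finrank ℝ E - 1) / 2) : ℝ) * (1 - 2 * a - 2 * b) ^ (-(1 / 2) : ℝ) := by
  have hq : 0 < 1 - 2 * a := by linarith
  have hsplit (z : E) : exp (a * ‖z‖ ^ 2 + b * (inner ℝ l z) ^ 2) =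
      exp (a * ‖z‖ ^ 2) • exp (b / (1 - 2 * a) * (inner ℝ l (√(1 - 2 * a) • z)) ^ 2) := by
    rw [inner_smul_right, mul_pow, sq_sqrt hq.le, ← mul_assoc, div_mul_cancel₀ _ hq.ne', exp_add,
      smul_eq_mul]
  have hmgf := mgf_sq_inner_stdGaussian hl (b := b / (1 - 2 * a))
    (by rw [div_lt_iff₀ hq]; linarith)
  have hfactor : 1 - 2 * (b / (1 - 2 * a)) = (1 - 2 * a - 2 * b) / (1 - 2 * a) := by field_simp
  have hexponent : (-((finrank ℝ E - 1) / 2) : ℝ) = -(finrank ℝ E / 2) - -(1 / 2) := by ring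
  simp_rw [hsplit]
  rw [integral_exp_mul_sq_norm_smul_stdGaussian ha
    (fun w => exp (b / (1 - 2 * a) * (inner ℝ l w) ^ 2)), ← mgf, hmgf, hfactor,
    div_rpow (by linarith) hq.le, hexponent, rpow_sub hq, smul_eq_mul]
  ring

theorem stdGaussian_cap_le {l : E} (hl : ‖l‖ = 1) {s q : ℝ} (hs : 0 < s) (hq : 1 ≤ q)
    (hqs : (q - 1) / s < q) :
    (stdGaussian E).real {z | s * ‖z‖ ^ 2 < (inner ℝ l z) ^ 2} ≤
      q ^ (-((finrank ℝ E - 1) / 2) : ℝ) * (q - (q - 1) / s) ^ (-(1 / 2) : ℝ) := by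
  -- Chernoff with this tilt weights `‖z‖²` by `-(q - 1) / 2`, whose normalising constant is the
  -- power of `q` in the bound.
  set t := (q - 1) / (2 * s) with ht
  have hts : t * s = (q - 1) / 2 := by rw [ht]; field_simp
  have h2t : 2 * t = (q - 1) / s := by rw [ht]; field_simp
  have ht0 : 0 ≤ t := div_nonneg (by linarith) (by linarith)
  have hint : mgf (fun z => (inner ℝ l z) ^ 2 - s * ‖z‖ ^ 2) (stdGaussian E) t =
      q ^ (-((finrank ℝ E - 1) / 2) : ℝ) * (q - (q - 1) / s) ^ (-(1 / 2) : ℝ) := by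
    have h := integral_exp_sq_norm_add_sq_inner_stdGaussian hl (a := -((q - 1) / 2)) (b := t)
      (by linarith) (by linarith)
    have hbase : 1 - 2 * -((q - 1) / 2) = q := by ring
    rw [hbase, h2t, ← hts] at h
    rw [← h, mgf]
    congr! 3
    ring
  have hpos : 0 < mgf (fun z => (inner ℝ l z) ^ 2 - s * ‖z‖ ^ 2) (stdGaussian E) t := by
    rw [hint]
    exact mul_pos (rpow_pos_of_pos (by linarith) _) (rpow_pos_of_pos (by linarith) _)
  have hsub : {z | s * ‖z‖ ^ 2 < (inner ℝ l z) ^ 2} ⊆ {z | 0 ≤ (inner ℝ l z) ^ 2 - s * ‖z‖ ^ 2} :=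
    Set.ofPred_subset_ofPred.2 fun _ hz => (sub_pos.2 hz).le
  calc _ ≤ (stdGaussian E).real {z | 0 ≤ (inner ℝ l z) ^ 2 - s * ‖z‖ ^ 2} := measureReal_mono hsub
    _ ≤ exp (-t * 0) * mgf (fun z => (inner ℝ l z) ^ 2 - s * ‖z‖ ^ 2) (stdGaussian E) t :=
        measure_ge_le_exp_mul_mgf 0 ht0 (mgf_pos_iff.1 hpos)
    _ = _ := by rw [mul_zero, exp_zero, one_mul, hint]

theorem neg_add_sq_le_log_one_sub {a : ℝ} (ha : |a| ≤ 1 / 4) : -(a + a ^ 2) ≤ log (1 - a) := by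
  have htaylor := (abs_le.1 (abs_log_sub_add_sum_range_le (by linarith : |a| < 1) 2)).1
  have hremainder : |a| ^ (2 + 1) / (1 - |a|) ≤ a ^ 2 / 2 := by
    rw [div_le_iff₀ (by linarith), pow_succ, sq_abs]
    nlinarith only [mul_le_mul_of_nonneg_left ha (sq_nonneg a)]
  simp only [Finset.sum_range_succ, Finset.sum_range_zero, Nat.cast_zero, Nat.cast_one] at htaylor
  linarith

theorem mgf_sq_norm_stdGaussian_le {a : ℝ} (ha : |a| ≤ 1 / 8) :
    mgf (fun z => ‖z‖ ^ 2) (stdGaussian E) a ≤ exp (finrank ℝ E * (a + 2 * a ^ 2)) := by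
  have ha' := abs_le.1 ha
  have hlog := neg_add_sq_le_log_one_sub (a := 2 * a) (by rw [abs_mul, abs_two]; linarith)
  rw [mgf_sq_norm_stdGaussian (by linarith), rpow_def_of_pos (by linarith), exp_le_exp]
  calc log (1 - 2 * a) * -(finrank ℝ E / 2 : ℝ)
      = finrank ℝ E / 2 * -log (1 - 2 * a) := by ring
    _ ≤ finrank ℝ E / 2 * (2 * a + (2 * a) ^ 2) := by
        gcongr
        linarith
    _ = finrank ℝ E * (a + 2 * a ^ 2) := by ring

theorem stdGaussian_le_sq_norm_le {t : ℝ} (ht : 0 ≤ t) (ht_half : t ≤ 1 / 2) :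
    (stdGaussian E).real {z | finrank ℝ E * (1 + t) ≤ ‖z‖ ^ 2} ≤
      exp (-(finrank ℝ E * t ^ 2 / 8)) := by
  calc _ ≤ exp (-(t / 4) * (finrank ℝ E * (1 + t))) *
        mgf (fun z => ‖z‖ ^ 2) (stdGaussian E) (t / 4) :=
        measure_ge_le_exp_mul_mgf _ (by linarith)
          (integrable_exp_mul_sq_norm_stdGaussian (by linarith))
    _ ≤ exp (-(t / 4) * (finrank ℝ E * (1 + t))) *
        exp (finrank ℝ E * (t / 4 + 2 * (t / 4) ^ 2)) := by
        gcongr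
        exact mgf_sq_norm_stdGaussian_le (by rw [abs_of_nonneg] <;> linarith)
    _ = _ := by rw [← exp_add]; ring_nf

theorem stdGaussian_sq_norm_le_le {t : ℝ} (ht : 0 ≤ t) (ht_half : t ≤ 1 / 2) :
    (stdGaussian E).real {z | ‖z‖ ^ 2 ≤ finrank ℝ E * (1 - t)} ≤
      exp (-(finrank ℝ E * t ^ 2 / 8)) := by
  calc _ ≤ exp (-(-(t / 4)) * (finrank ℝ E * (1 - t))) *
        mgf (fun z => ‖z‖ ^ 2) (stdGaussian E) (-(t / 4)) :=
        measure_le_le_exp_mul_mgf _ (by linarith)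
          (integrable_exp_mul_sq_norm_stdGaussian (by linarith))
    _ ≤ exp (-(-(t / 4)) * (finrank ℝ E * (1 - t))) *
        exp (finrank ℝ E * (-(t / 4) + 2 * (-(t / 4)) ^ 2)) := by
        gcongr
        exact mgf_sq_norm_stdGaussian_le (by rw [abs_neg, abs_of_nonneg] <;> linarith)
    _ = _ := by rw [← exp_add]; ring_nf

theorem integral_Ioi_mul_exp_neg_sq_div_two {x : ℝ} (hx : 0 ≤ x) :
    IntegrableOn (fun y => y * exp (-y ^ 2 / 2)) (Set.Ioi x) ∧
      ∫ y in Set.Ioi x, y * exp (-y ^ 2 / 2) = exp (-x ^ 2 / 2) := by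
  have hderiv (y : ℝ) : HasDerivAt (fun y => -exp (-y ^ 2 / 2)) (y * exp (-y ^ 2 / 2)) y := by
    convert! ((hasDerivAt_pow 2 y).neg.div_const 2).exp.neg using 1
    simp only [Pi.neg_apply, neg_div, Nat.cast_ofNat, Nat.add_one_sub_one, pow_one]
    ring
  have hlim : Tendsto (fun y : ℝ => -exp (-y ^ 2 / 2)) atTop (𝓝 0) := by
    rw [← neg_zero]
    simp_rw [neg_div]
    exact (tendsto_exp_neg_atTop_nhds_zero.comp
      ((tendsto_pow_atTop two_ne_zero).atTop_div_const two_pos)).neg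
  have hnonneg : ∀ y ∈ Set.Ioi x, 0 ≤ y * exp (-y ^ 2 / 2) := fun y hy =>
    mul_nonneg (hx.trans (le_of_lt hy)) (exp_pos _).le
  refine ⟨integrableOn_Ioi_deriv_of_nonneg' (fun y _ => hderiv y) hnonneg hlim, ?_⟩
  rw [integral_Ioi_of_hasDerivAt_of_nonneg' (fun y _ => hderiv y) hnonneg hlim, zero_sub, neg_neg]

theorem gaussianReal_Ioi_le {x : ℝ} (hx : 0 < x) :
    (gaussianReal 0 1).real (Set.Ioi x) ≤ (√(2 * π))⁻¹ * exp (-x ^ 2 / 2) / x := by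
  obtain ⟨hint, heq⟩ := integral_Ioi_mul_exp_neg_sq_div_two hx.le
  rw [measureReal_def, gaussianReal_apply_eq_integral _ one_ne_zero,
    ENNReal.toReal_ofReal (integral_nonneg fun _ => gaussianPDFReal_nonneg _ _ _)]
  calc ∫ y in Set.Ioi x, gaussianPDFReal 0 1 y
      ≤ ∫ y in Set.Ioi x, (√(2 * π))⁻¹ / x * (y * exp (-y ^ 2 / 2)) := by
        refine setIntegral_mono_on (integrable_gaussianPDFReal 0 1).integrableOn
          (hint.const_mul _) measurableSet_Ioi fun y hy => ?_
        have hratio : 1 ≤ y / x := (one_le_div hx).2 (le_of_lt hy)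
        calc gaussianPDFReal 0 1 y = (√(2 * π))⁻¹ * (1 * exp (-y ^ 2 / 2)) := by
              simp [gaussianPDFReal]
          _ ≤ (√(2 * π))⁻¹ * (y / x * exp (-y ^ 2 / 2)) := by gcongr
          _ = _ := by ring
    _ = _ := by rw [integral_const_mul, heq]; ring

theorem gaussianReal_lt_abs_le {x : ℝ} (hx : 0 < x) :
    (gaussianReal 0 1).real {y | x < |y|} ≤ exp (-x ^ 2 / 2) / x := by
  have hsymm : (gaussianReal 0 1).real (Set.Iio (-x)) = (gaussianReal 0 1).real (Set.Ioi x) := by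
    have hneg := gaussianReal_map_neg (μ := 0) (v := 1)
    rw [neg_zero] at hneg
    nth_rewrite 1 [← hneg]
    rw [map_measureReal_apply measurable_neg measurableSet_Iio, Set.neg_preimage, Set.neg_Iio,
      neg_neg]
  have hunion : {y : ℝ | x < |y|} = Set.Ioi x ∪ Set.Iio (-x) := by
    ext y
    simp [lt_abs, lt_neg]
  have htwo : 2 * (√(2 * π))⁻¹ ≤ 1 := by
    rw [← div_eq_mul_inv, div_le_one (by positivity)]
    exact le_sqrt_of_sq_le (by linarith [pi_gt_three])
  calc (gaussianReal 0 1).real {y | x < |y|}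
      ≤ (gaussianReal 0 1).real (Set.Ioi x) + (gaussianReal 0 1).real (Set.Iio (-x)) :=
        hunion ▸ measureReal_union_le _ _
    _ ≤ 2 * ((√(2 * π))⁻¹ * exp (-x ^ 2 / 2) / x) := by
        rw [hsymm, ← two_mul]
        gcongr
        exact gaussianReal_Ioi_le hx
    _ = 2 * (√(2 * π))⁻¹ * (exp (-x ^ 2 / 2) / x) := by ring
    _ ≤ exp (-x ^ 2 / 2) / x := mul_le_of_le_one_left (by positivity) htwo

theorem stdGaussian_lt_abs_inner_le {l : E} (hl : ‖l‖ = 1) {x : ℝ} (hx : 0 < x) :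
    (stdGaussian E).real {z | x < |inner ℝ l z|} ≤ exp (-x ^ 2 / 2) / x := by
  refine le_of_eq_of_le ?_ (gaussianReal_lt_abs_le hx)
  rw [← map_inner_stdGaussian hl, map_measureReal_apply (by fun_prop)
    (measurableSet_lt (by fun_prop) (by fun_prop))]
  rfl

theorem setIntegral_exp_mul_sq_norm_stdGaussian {a : ℝ} (ha : a < 1 / 2) {A : Set E}
    (hA : MeasurableSet A) :
    ∫ z in {z | √(1 - 2 * a) • z ∈ A}, exp (a * ‖z‖ ^ 2) ∂(stdGaussian E) =
      (1 - 2 * a) ^ (-(finrank ℝ E / 2 : ℝ)) * (stdGaussian E).real A := by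
  have h := integral_exp_mul_sq_norm_smul_stdGaussian ha (A.indicator fun _ => (1 : ℝ))
  rw [integral_indicator_const _ hA, smul_eq_mul, smul_eq_mul, mul_one] at h
  have hmeas : MeasurableSet {z : E | √(1 - 2 * a) • z ∈ A} := measurable_const_smul _ hA
  rw [← h, ← integral_indicator hmeas]
  refine integral_congr_ae (.of_forall fun z => ?_)
  by_cases hz : √(1 - 2 * a) • z ∈ A <;> simp [hz]

theorem stdGaussian_smul_mem_and_sq_norm_le {q : ℝ} (hq : 1 ≤ q) (D : ℝ) {A : Set E}
    (hA : MeasurableSet A) :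
    (stdGaussian E).real {z | √q • z ∈ A ∧ ‖z‖ ^ 2 ≤ D} ≤
      exp ((q - 1) / 2 * D) * (q ^ (-(finrank ℝ E / 2 : ℝ)) * (stdGaussian E).real A) := by
  have hbase : 1 - 2 * -((q - 1) / 2) = q := by ring
  have htilt := setIntegral_exp_mul_sq_norm_stdGaussian (a := -((q - 1) / 2)) (by linarith) hA
  have hball : MeasurableSet {z : E | ‖z‖ ^ 2 ≤ D} := measurableSet_le (by fun_prop) (by fun_prop)
  have hmeas : MeasurableSet {z : E | √q • z ∈ A ∧ ‖z‖ ^ 2 ≤ D} :=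
    (measurable_const_smul (√q) hA).inter hball
  have hint : Integrable (fun z : E => exp ((q - 1) / 2 * D) * exp (-((q - 1) / 2) * ‖z‖ ^ 2))
      (stdGaussian E) :=
    (integrable_exp_mul_sq_norm_stdGaussian (by linarith)).const_mul _
  rw [hbase] at htilt
  rw [← htilt, ← integral_const_mul]
  calc (stdGaussian E).real {z | √q • z ∈ A ∧ ‖z‖ ^ 2 ≤ D}
      = ∫ _ in {z | √q • z ∈ A ∧ ‖z‖ ^ 2 ≤ D}, (1 : ℝ) ∂(stdGaussian E) := by simp
    _ ≤ ∫ z in {z | √q • z ∈ A ∧ ‖z‖ ^ 2 ≤ D},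
          exp ((q - 1) / 2 * D) * exp (-((q - 1) / 2) * ‖z‖ ^ 2) ∂(stdGaussian E) := by
        refine setIntegral_mono_on (integrable_const _) hint.integrableOn hmeas fun _ hz => ?_
        rw [← exp_add, one_le_exp_iff]
        linarith [mul_le_mul_of_nonneg_left hz.2 (by linarith : 0 ≤ (q - 1) / 2)]
    _ ≤ _ := setIntegral_mono_set hint.integrableOn (.of_forall fun _ => by positivity)
        (.of_forall fun _ hz => hz.1)

theorem stdGaussian_lt_abs_inner_and_sq_norm_le {l : E} (hl : ‖l‖ = 1) {q b : ℝ} (hq : 1 ≤ q)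
    (hb : 0 < b) (D : ℝ) :
    (stdGaussian E).real {z | b < |inner ℝ l z| ∧ ‖z‖ ^ 2 ≤ D} ≤
      exp ((q - 1) / 2 * D) *
        (q ^ (-(finrank ℝ E / 2 : ℝ)) * (exp (-(√q * b) ^ 2 / 2) / (√q * b))) := by
  have hsqrt : 0 < √q := sqrt_pos.2 (by linarith)
  have hscale (z : E) : b < |inner ℝ l z| ↔ √q * b < |inner ℝ l (√q • z)| := by
    rw [inner_smul_right, abs_mul, abs_of_pos hsqrt, mul_lt_mul_iff_right₀ hsqrt]
  simp_rw [hscale]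
  refine (stdGaussian_smul_mem_and_sq_norm_le hq D (A := {z | √q * b < |inner ℝ l z|})
    (measurableSet_lt (by fun_prop) (by fun_prop))).trans ?_
  gcongr
  exact stdGaussian_lt_abs_inner_le hl (by positivity)

end StdGaussian

/-! ### Radial laws -/

section Radial

variable {E : Type*} [NormedAddCommGroup E] [NormedSpace ℝ E] [FiniteDimensional ℝ E]
  [Nontrivial E] [MeasurableSpace E] [BorelSpace E]

theorem withDensity_norm_apply_cone (μ : Measure E) [μ.IsAddHaarMeasure] {h : ℝ → ENNReal}
    (hh : Measurable h) {A : Set E} (hA : MeasurableSet A)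
    (hcone : ∀ c : ℝ, 0 < c → ∀ x ∈ A, c • x ∈ A) :
    μ.withDensity (fun v => h ‖v‖) A = μ.toSphere ((↑) ⁻¹' A) *
      ∫⁻ r : Set.Ioi (0 : ℝ), h r ∂(Measure.volumeIoiPow (Module.finrank ℝ E - 1)) := by
  have hmem (c : ℝ) (hc : 0 < c) (x : E) : c • x ∈ A ↔ x ∈ A :=
    ⟨fun hx => by simpa [smul_smul, hc.ne'] using hcone c⁻¹ (inv_pos.2 hc) _ hx, hcone c hc x⟩
  have hA' : MeasurableSet ((↑) ⁻¹' A : Set (Metric.sphere (0 : E) 1)) := measurable_subtype_coe hA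
  have hh' : Measurable fun r : Set.Ioi (0 : ℝ) => h r := hh.comp measurable_subtype_coe
  set F : Metric.sphere (0 : E) 1 × Set.Ioi (0 : ℝ) → ENNReal :=
    fun y => ((↑) ⁻¹' A : Set (Metric.sphere (0 : E) 1)).indicator 1 y.1 * h y.2 with hF
  calc μ.withDensity (fun v => h ‖v‖) A
      = ∫⁻ v in ({0}ᶜ : Set E), A.indicator (fun v => h ‖v‖) v ∂μ := by
        rw [withDensity_apply _ hA, lintegral_indicator hA, restrict_compl_singleton]
    _ = ∫⁻ v : ({0}ᶜ : Set E), A.indicator (fun v => h ‖v‖) (v : E) ∂(μ.comap (↑)) :=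
        (lintegral_subtype_comap (measurableSet_singleton _).compl _).symm
    _ = ∫⁻ v : ({0}ᶜ : Set E), F (homeomorphUnitSphereProd E v) ∂(μ.comap (↑)) := by
        refine lintegral_congr fun v => ?_
        have hv := hmem ‖(v : E)‖⁻¹ (inv_pos.2 (norm_pos_iff.2 v.2)) v
        by_cases hvA : (v : E) ∈ A <;> simp [hF, Set.indicator, hv, hvA]
    _ = ∫⁻ y, F y ∂(μ.toSphere.prod (Measure.volumeIoiPow (Module.finrank ℝ E - 1))) :=
        μ.measurePreserving_homeomorphUnitSphereProd.lintegral_comp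
          (((measurable_one.indicator hA').comp measurable_fst).mul (hh'.comp measurable_snd))
    _ = _ := by
        rw [lintegral_prod_mul (measurable_one.indicator hA').aemeasurable hh'.aemeasurable,
          lintegral_indicator_one hA']

end Radial

section RadialLaw

variable {E : Type*} [NormedAddCommGroup E] [InnerProductSpace ℝ E] [FiniteDimensional ℝ E]
  [MeasurableSpace E] [BorelSpace E]

/-- `ν` is a spherically symmetric law with a Lebesgue density: a probability measure whose density
depends on the norm alone. The law of `Z_d ∼ EC_d(0, I)` is of this kind. -/
def IsRadialLaw (ν : Measure E) : Prop :=
  IsProbabilityMeasure ν ∧ ∃ h : ℝ → ENNReal, Measurable h ∧ ν = volume.withDensity fun v => h ‖v‖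

theorem isRadialLaw_stdGaussian : IsRadialLaw (stdGaussian E) :=
  ⟨inferInstance, fun r => ENNReal.ofReal ((2 * Real.pi) ^ (-(Module.finrank ℝ E / 2 : ℝ)) *
    Real.exp (-(1 / 2) * r ^ 2)), by fun_prop, stdGaussian_eq_withDensity⟩

theorem IsEllipticalLaw.isRadialLaw {d : ℕ} {ν : Measure (EuclideanSpace ℝ (Fin d))}
    (hν : IsEllipticalLaw 0 1 ν) : IsRadialLaw ν := by
  obtain ⟨hprob, -, g, hg, -, c, -, hdensity⟩ := hν
  have hcont : Continuous fun r : ℝ => g (r ^ 2) :=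
    hg.comp_continuous (by fun_prop) fun r => Set.mem_Ici.2 (sq_nonneg r)
  refine ⟨hprob, fun r => ENNReal.ofReal (c * g (r ^ 2)),
    (hcont.measurable.const_mul c).ennreal_ofReal, ?_⟩
  have hnorm (v : EuclideanSpace ℝ (Fin d)) : v.ofLp ⬝ᵥ v.ofLp = ‖v‖ ^ 2 := by
    rw [EuclideanSpace.real_norm_sq_eq, dotProduct]
    simp_rw [sq]
  simp [hdensity, hnorm]

theorem IsRadialLaw.measure_cone_eq [Nontrivial E] {ν₁ ν₂ : Measure E} (h₁ : IsRadialLaw ν₁)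
    (h₂ : IsRadialLaw ν₂) {A : Set E} (hA : MeasurableSet A)
    (hcone : ∀ c : ℝ, 0 < c → ∀ x ∈ A, c • x ∈ A) : ν₁ A = ν₂ A := by
  suffices key : ∀ ν : Measure E, IsRadialLaw ν → ν A =
      (volume : Measure E).toSphere ((↑) ⁻¹' A) * ((volume : Measure E).toSphere Set.univ)⁻¹ by
    rw [key ν₁ h₁, key ν₂ h₂]
  rintro ν ⟨hprob, h, hh, hdensity⟩
  have htotal := withDensity_norm_apply_cone volume hh (MeasurableSet.univ (α := E))
    fun _ _ _ _ => Set.mem_univ _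
  rw [← hdensity, measure_univ, Set.preimage_univ, mul_comm] at htotal
  rw [← ENNReal.eq_inv_of_mul_eq_one_left htotal.symm, hdensity,
    withDensity_norm_apply_cone volume hh hA hcone]

theorem IsRadialLaw.cap_le {ν : Measure E} (hν : IsRadialLaw ν) {l : E} (hl : ‖l‖ = 1) {s q : ℝ}
    (hs : 0 < s) (hq : 1 ≤ q) (hqs : (q - 1) / s < q) :
    ν.real {z | s * ‖z‖ ^ 2 < (inner ℝ l z) ^ 2} ≤
      q ^ (-((Module.finrank ℝ E - 1) / 2) : ℝ) * (q - (q - 1) / s) ^ (-(1 / 2) : ℝ) := by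
  have : Nontrivial E := nontrivial_of_ne l 0 (norm_ne_zero_iff.1 (by rw [hl]; exact one_ne_zero))
  have hA : MeasurableSet {z | s * ‖z‖ ^ 2 < (inner ℝ l z) ^ 2} :=
    measurableSet_lt (by fun_prop) (by fun_prop)
  have hcone (c : ℝ) (hc : 0 < c) (z : E) (hz : s * ‖z‖ ^ 2 < (inner ℝ l z) ^ 2) :
      s * ‖c • z‖ ^ 2 < (inner ℝ l (c • z)) ^ 2 := by
    rw [inner_smul_right, norm_smul, mul_pow, mul_pow, Real.norm_eq_abs, sq_abs, mul_left_comm]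
    exact mul_lt_mul_of_pos_left hz (pow_pos hc 2)
  rw [measureReal_def, hν.measure_cone_eq isRadialLaw_stdGaussian hA hcone, ← measureReal_def]
  exact stdGaussian_cap_le hl hs hq hqs

end RadialLaw

/-! ### Gram vectors -/

section Gram

variable {ι E : Type*} [NormedAddCommGroup E] [InnerProductSpace ℝ E]

/-- The vector of inner products of `z` with the `l j`, that is `Lᵀ z` for the matrix `L` whose
columns are the `l j`. -/
noncomputable def innerVec (l : ι → E) (z : E) : EuclideanSpace ℝ ι :=
  WithLp.toLp 2 fun j => inner ℝ (l j) z

theorem innerVec_toLp_col {κ : Type*} [Fintype κ] (L : Matrix κ ι ℝ) (z : EuclideanSpace ℝ κ) :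
    innerVec (fun j => WithLp.toLp 2 (L.col j)) z = WithLp.toLp 2 (Lᵀ *ᵥ z.ofLp) := by
  ext j
  simp only [innerVec, EuclideanSpace.inner_eq_star_dotProduct, star_trivial]
  exact dotProduct_comm z.ofLp (L.col j)

theorem gram_toLp_col {κ : Type*} [Fintype κ] (L : Matrix κ ι ℝ) :
    gram ℝ (fun j => WithLp.toLp 2 (L.col j)) = Lᵀ * L := by
  ext j k
  simp [gram_apply, EuclideanSpace.inner_eq_star_dotProduct, mul_apply, dotProduct, mul_comm]

theorem exists_linearIsometry_of_finrank_le {F : Type*} [NormedAddCommGroup F]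
    [InnerProductSpace ℝ F] [FiniteDimensional ℝ E] [FiniteDimensional ℝ F]
    (h : Module.finrank ℝ F ≤ Module.finrank ℝ E) : Nonempty (F →ₗᵢ[ℝ] E) := by
  let v := stdOrthonormalBasis ℝ F
  let w := stdOrthonormalBasis ℝ E
  let f : F →ₗ[ℝ] E := v.toBasis.constr ℝ (w ∘ Fin.castLE h)
  have hfv : f ∘ v.toBasis = w ∘ Fin.castLE h := funext fun i => v.toBasis.constr_basis ℝ _ i
  exact ⟨f.isometryOfOrthonormal (v := v.toBasis) (by simp)
    (hfv ▸ w.orthonormal.comp _ (Fin.castLE_injective h))⟩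

theorem exists_gram_eq [Fintype ι] [FiniteDimensional ℝ E] {S : Matrix ι ι ℝ} (hS : S.PosSemidef)
    (hrank : S.rank ≤ Module.finrank ℝ E) : ∃ l : ι → E, gram ℝ l = S := by
  classical
  obtain ⟨B, rfl⟩ : ∃ B : Matrix ι ι ℝ, S = Bᴴ * B := by
    open scoped MatrixOrder in
    exact CStarAlgebra.nonneg_iff_eq_star_mul_self.1 hS.nonneg
  let f := toEuclideanLin B
  have hrange : Module.finrank ℝ (LinearMap.range f) = B.rank :=
    (rank_eq_finrank_range_toLin B (EuclideanSpace.basisFun ι ℝ).toBasis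
      (EuclideanSpace.basisFun ι ℝ).toBasis).symm
  rw [rank_conjTranspose_mul_self, ← hrange] at hrank
  obtain ⟨V⟩ := exists_linearIsometry_of_finrank_le hrank
  refine ⟨fun j => V (f.rangeRestrict (EuclideanSpace.single j 1)), ?_⟩
  have hcol (j : ι) : f (EuclideanSpace.single j 1) = WithLp.toLp 2 (B.col j) := by
    simp [f, toLpLin_apply]
  rw [conjTranspose_eq_transpose_of_trivial, ← gram_toLp_col]
  ext j k
  rw [gram_apply, gram_apply, V.inner_map_map, Submodule.coe_inner, ← hcol, ← hcol]
  rfl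

theorem IsCorrelationMatrix.norm_eq_one_of_gram_eq {p : ℕ} {l : Fin p → E}
    {S : Matrix (Fin p) (Fin p) ℝ} (hS : IsCorrelationMatrix S) (hl : gram ℝ l = S) (j : Fin p) :
    ‖l j‖ = 1 := by
  rw [← sq_eq_sq₀ (norm_nonneg _) zero_le_one, ← real_inner_self_eq_norm_sq, one_pow,
    ← gram_apply, hl, hS.2 j]

theorem inner_innerVec [Fintype ι] (l : ι → E) (z : E) (t : EuclideanSpace ℝ ι) :
    inner ℝ (innerVec l z) t = inner ℝ z (∑ j, t j • l j) := by
  simp [innerVec, PiLp.inner_apply, inner_sum, inner_smul_right, real_inner_comm]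

variable [MeasurableSpace E] [BorelSpace E]

theorem measurable_innerVec (l : ι → E) : Measurable (innerVec l) := by
  unfold innerVec
  fun_prop

theorem map_innerVec_stdGaussian [Fintype ι] [DecidableEq ι] [FiniteDimensional ℝ E] (l : ι → E) :
    (stdGaussian E).map (innerVec l) = multivariateGaussian 0 (gram ℝ l) := by
  have := Measure.isProbabilityMeasure_map (μ := stdGaussian E)
    (measurable_innerVec l).aemeasurable
  refine Measure.ext_of_charFun (funext fun t => ?_)
  have hquad : t.ofLp ⬝ᵥ gram ℝ l *ᵥ t.ofLp = ‖∑ j, t j • l j‖ ^ 2 := by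
    rw [← real_inner_self_eq_norm_sq, ← star_dotProduct_gram_mulVec, star_trivial]
  rw [charFun_multivariateGaussian (posSemidef_gram ℝ l), hquad, charFun_apply,
    integral_map (measurable_innerVec l).aemeasurable (by fun_prop)]
  simp_rw [inner_innerVec]
  rw [← charFun_apply, charFun_stdGaussian]
  simp [neg_div]

end Gram

section MaxNorm

variable {p : ℕ}

theorem measurable_maxNorm : Measurable (maxNorm (p := p)) := by
  unfold maxNorm
  exact Measurable.iSup fun j => by fun_prop

theorem lt_maxNorm_iff {x : EuclideanSpace ℝ (Fin p)} {a : ℝ} (ha : 0 ≤ a) :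
    a < maxNorm x ↔ ∃ j, a < |x j| := by
  rcases isEmpty_or_nonempty (Fin p)
  · simp [maxNorm, Real.iSup_of_isEmpty, ha]
  · exact lt_ciSup_iff (Set.finite_range _).bddAbove

variable {E Ω : Type*} [NormedAddCommGroup E] [InnerProductSpace ℝ E] [MeasurableSpace E]
  [BorelSpace E] [MeasurableSpace Ω] {ν : Measure E} {P : Measure Ω} {l : Fin p → E}
  {X : Ω → EuclideanSpace ℝ (Fin p)}

theorem measureReal_lt_maxNorm (hX : HasLaw X (ν.map (innerVec l)) P) {a : ℝ} (ha : 0 ≤ a) :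
    P.real {ω | a < maxNorm (X ω)} = ν.real {z | ∃ j, a < |inner ℝ (l j) z|} := by
  have hmeas : MeasurableSet {x : EuclideanSpace ℝ (Fin p) | a < maxNorm x} :=
    measurableSet_lt measurable_const measurable_maxNorm
  rw [hX.measureReal_eq hmeas, map_measureReal_apply (measurable_innerVec l) hmeas]
  simp only [lt_maxNorm_iff ha]
  rfl

theorem measureReal_lt_maxNorm_div_le [IsFiniteMeasure ν] (hX : HasLaw X (ν.map (innerVec l)) P)
    {c r : ℝ} (hc : 0 ≤ c) (hr : 0 ≤ r) :
    P.real {ω | maxNorm (X ω) / r > c} ≤ ν.real {z | ∃ j, c * r < |inner ℝ (l j) z|} := by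
  have := hX.isFiniteMeasure
  rw [← measureReal_lt_maxNorm hX (mul_nonneg hc hr)]
  refine measureReal_mono fun ω (hω : c < maxNorm (X ω) / r) => ?_
  have hr_pos : 0 < r := hr.lt_of_ne fun h => hc.not_gt (by simpa [← h] using hω)
  exact (lt_div_iff₀ hr_pos).1 hω

theorem one_sub_le_measureReal_maxNorm_div_le_one [IsProbabilityMeasure ν]
    (hX : HasLaw X (ν.map (innerVec l)) P) {r : ℝ} (hr : 0 ≤ r) :
    1 - ν.real {z | ∃ j, r < |inner ℝ (l j) z|} ≤ P.real {ω | maxNorm (X ω) / r ≤ 1} := by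
  have := Measure.isProbabilityMeasure_map (μ := ν) (measurable_innerVec l).aemeasurable
  have := hX.isProbabilityMeasure
  have hcover : Set.univ ⊆ {ω | r < maxNorm (X ω)} ∪ {ω | maxNorm (X ω) / r ≤ 1} := fun ω _ =>
    (lt_or_ge r (maxNorm (X ω))).imp_right fun h => div_le_one_of_le₀ h hr
  have hsum := (measureReal_mono (μ := P) hcover).trans (measureReal_union_le _ _)
  rw [probReal_univ, measureReal_lt_maxNorm hX hr] at hsum
  linarith

end MaxNorm

/-! ### The union bound over caps -/

section Rate

open Real

/-- `q = p ^ (2 / (d - 1))`, the number for which `q ^ (-(d - 1) / 2) = 1 / p`: the order of the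
mass of the caps `{(1 - 1 / q) ‖z‖² < ⟪l, z⟫²}`. It gives `rexBound u p d = √(u (1 - 1 / q))`. -/
noncomputable def rexBase (p d : ℕ) : ℝ := (p : ℝ) ^ (2 / ((d : ℝ) - 1))

theorem rexBound_eq (u : ℝ) (p d : ℕ) : rexBound u p d = √(u * (1 - (rexBase p d)⁻¹)) := by
  rw [rexBound, rexBase, neg_div, rpow_neg p.cast_nonneg]

theorem rexBound_nonneg (u : ℝ) (p d : ℕ) : 0 ≤ rexBound u p d := sqrt_nonneg _

variable {p d : ℕ}

theorem one_lt_rexBase (hp : 2 ≤ p) (hd : 2 ≤ d) : 1 < rexBase p d := by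
  have hp' : (2 : ℝ) ≤ p := by exact_mod_cast hp
  have hd' : (2 : ℝ) ≤ d := by exact_mod_cast hd
  exact one_lt_rpow (by linarith) (div_pos two_pos (by linarith))

theorem rexBase_rpow (p : ℕ) (hd : 2 ≤ d) : rexBase p d ^ (-((d - 1) / 2) : ℝ) = (p : ℝ)⁻¹ := by
  have hd' : (2 : ℝ) ≤ d := by exact_mod_cast hd
  have hexponent : 2 / ((d : ℝ) - 1) * -((d - 1) / 2) = -1 := by
    field_simp [(by linarith : (d : ℝ) - 1 ≠ 0)]
  rw [rexBase, ← rpow_mul p.cast_nonneg, hexponent, rpow_neg_one]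

theorem two_mul_log_le_mul_rexBase_sub_one (hp : p ≠ 0) (hd : 2 ≤ d) :
    2 * log p ≤ (d - 1) * (rexBase p d - 1) := by
  have hd' : (2 : ℝ) ≤ d := by exact_mod_cast hd
  have hpos : (0 : ℝ) < d - 1 := by linarith
  have hexp := add_one_le_exp (log p * (2 / ((d : ℝ) - 1)))
  rw [← rpow_def_of_pos (by positivity), ← rexBase] at hexp
  calc 2 * log p = (d - 1) * (log p * (2 / (d - 1))) := by field_simp
    _ ≤ (d - 1) * (rexBase p d - 1) := by gcongr; linarith

theorem one_add_mul_log_le_rpow (hp : 2 ≤ p) (hd : 3 ≤ d) {η : ℝ} (hη : 0 ≤ η) :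
    1 + η * log p ≤ (1 + η * (rexBase p d - 1)) ^ ((d - 1) / 2 : ℝ) := by
  have hd' : (3 : ℝ) ≤ d := by exact_mod_cast hd
  have hq := one_lt_rexBase hp (by lia : 2 ≤ d)
  have hηq : 0 ≤ η * (rexBase p d - 1) := mul_nonneg hη (by linarith)
  calc 1 + η * log p ≤ 1 + η * ((d - 1) * (rexBase p d - 1) / 2) := by
        gcongr
        linarith [two_mul_log_le_mul_rexBase_sub_one (by lia : p ≠ 0) (by lia : 2 ≤ d)]
    _ = 1 + (d - 1) / 2 * (η * (rexBase p d - 1)) := by ring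
    _ ≤ _ := one_add_mul_self_le_rpow_one_add (by linarith) (by linarith)

end Rate

section Elliptical

open Real

theorem measureReal_iUnion_le_of_card_mul_le {Ω ι : Type*} [MeasurableSpace Ω] {μ : Measure Ω}
    [Fintype ι] [Nonempty ι] {s : ι → Set Ω} {C : ℝ}
    (h : ∀ i, Fintype.card ι * μ.real (s i) ≤ C) : μ.real (⋃ i, s i) ≤ C := by
  have hcard : (0 : ℝ) < Fintype.card ι := by exact_mod_cast Fintype.card_pos
  calc μ.real (⋃ i, s i) ≤ ∑ i, μ.real (s i) := measureReal_iUnion_fintype_le _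
    _ ≤ ∑ _i : ι, C / Fintype.card ι := Finset.sum_le_sum fun i _ => (le_div_iff₀' hcard).2 (h i)
    _ = C := by
      rw [Finset.sum_const, Finset.card_univ, nsmul_eq_mul, mul_div_cancel₀ _ hcard.ne']

variable {p d : ℕ}

theorem div_le_mul_sub_mul_sub_one_div {q δ : ℝ} (hq : 1 < q) (hδ : 0 < δ) :
    δ / (2 * (1 + δ)) ≤ q * (1 + δ / 2 * (q - 1)) -
      (q * (1 + δ / 2 * (q - 1)) - 1) / ((1 + δ) * (1 - q⁻¹)) := by
  have hq_sub : 0 < q - 1 := by linarith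
  have hprod : 0 < δ * δ * (q - 1) := by positivity
  have hfactor : (1 + δ) * (1 - q⁻¹) = (1 + δ) * (q - 1) / q := by field_simp
  calc δ / (2 * (1 + δ)) = 1 * (δ / 2) / (1 + δ) := by field_simp
    _ ≤ q * (δ / 2 + δ * (δ / 2) * (q - 1)) / (1 + δ) := by
        gcongr
        linarith
    _ = _ := by
        rw [hfactor]
        field_simp
        ring

theorem IsRadialLaw.mul_rex_cap_le {ν : Measure (EuclideanSpace ℝ (Fin d))} (hν : IsRadialLaw ν)
    (hp : 2 ≤ p) (hd : 3 ≤ d) {l : EuclideanSpace ℝ (Fin d)} (hl : ‖l‖ = 1) {δ : ℝ} (hδ : 0 < δ) :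
    p * ν.real {z | (1 + δ) * (1 - (rexBase p d)⁻¹) * ‖z‖ ^ 2 < (inner ℝ l z) ^ 2} ≤
      (1 + δ / 2 * log p)⁻¹ * (δ / (2 * (1 + δ))) ^ (-(1 / 2) : ℝ) := by
  have hp_pos : (0 : ℝ) < p := by exact_mod_cast (by lia : 0 < p)
  have hpow := one_add_mul_log_le_rpow hp hd (half_pos hδ).le
  have hbase := rexBase_rpow p (by lia : 2 ≤ d)
  have hq := one_lt_rexBase hp (by lia : 2 ≤ d)
  set q := rexBase p d
  -- Applied at `q * r`, `cap_le` beats `1 / p` by the factor `r ^ (-(d - 1) / 2)`, which tends to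
  -- `0`; half of `δ` goes into `r`, the other half keeps the last factor of the bound finite.
  set r := 1 + δ / 2 * (q - 1) with hr
  set s := (1 + δ) * (1 - q⁻¹)
  have hq_pos : 0 < q := by linarith
  have hq_sub : 0 < q - 1 := by linarith
  have hr_one : 1 ≤ r := by
    rw [hr]
    nlinarith only [mul_pos hδ hq_sub]
  have hs_pos : 0 < s := mul_pos (by linarith) (sub_pos.2 (inv_lt_one_of_one_lt₀ hq))
  have hgap : δ / (2 * (1 + δ)) ≤ q * r - (q * r - 1) / s := div_le_mul_sub_mul_sub_one_div hq hδ
  have hgap_pos : 0 < δ / (2 * (1 + δ)) := by positivity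
  have hcap := hν.cap_le hl hs_pos (one_le_mul_of_one_le_of_one_le hq.le hr_one)
    (by linarith : (q * r - 1) / s < q * r)
  rw [finrank_euclideanSpace_fin, mul_rpow hq_pos.le (by linarith), hbase,
    rpow_neg (x := r) (by linarith)] at hcap
  calc _ ≤ p * ((p : ℝ)⁻¹ * (r ^ ((d - 1) / 2 : ℝ))⁻¹ *
        (q * r - (q * r - 1) / s) ^ (-(1 / 2) : ℝ)) := by gcongr
    _ = (r ^ ((d - 1) / 2 : ℝ))⁻¹ * (q * r - (q * r - 1) / s) ^ (-(1 / 2) : ℝ) := by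
        rw [mul_assoc, mul_inv_cancel_left₀ hp_pos.ne']
    _ ≤ _ := mul_le_mul (inv_anti₀ (by positivity) hpow)
        (rpow_le_rpow_of_nonpos hgap_pos hgap (by norm_num))
        (rpow_nonneg (hgap_pos.le.trans hgap) _) (by positivity)

theorem IsRadialLaw.measureReal_exists_rexBound_lt_le {ν : Measure (EuclideanSpace ℝ (Fin d))}
    (hν : IsRadialLaw ν) (hp : 2 ≤ p) (hd : 3 ≤ d) {l : Fin p → EuclideanSpace ℝ (Fin d)}
    (hl : ∀ j, ‖l j‖ = 1) {u δ : ℝ} (hu : 0 < u) (hδ : 0 < δ) :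
    ν.real {z | ∃ j, (1 + δ) * rexBound u p d < |inner ℝ (l j) z|} ≤
      ν.real {z | δ < |‖z‖ ^ 2 / u - 1|} +
        (1 + δ / 2 * log p)⁻¹ * (δ / (2 * (1 + δ))) ^ (-(1 / 2) : ℝ) := by
  have := hν.1
  have : Nonempty (Fin p) := ⟨⟨0, by lia⟩⟩
  have hq : 0 < 1 - (rexBase p d)⁻¹ :=
    sub_pos.2 (inv_lt_one_of_one_lt₀ (one_lt_rexBase hp (by lia)))
  have hcaps : {z | ∃ j, (1 + δ) * rexBound u p d < |inner ℝ (l j) z|} ⊆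
      {z | δ < |‖z‖ ^ 2 / u - 1|} ∪
        ⋃ j, {z | (1 + δ) * (1 - (rexBase p d)⁻¹) * ‖z‖ ^ 2 < (inner ℝ (l j) z) ^ 2} := by
    rintro z ⟨j, hj⟩
    refine or_iff_not_imp_left.2 fun (hz : ¬δ < |‖z‖ ^ 2 / u - 1|) => Set.mem_iUnion.2 ⟨j, ?_⟩
    have hnorm : ‖z‖ ^ 2 ≤ (1 + δ) * u := by
      rw [← div_le_iff₀ hu]
      linarith [(abs_le.1 (not_lt.1 hz)).2]
    calc (1 + δ) * (1 - (rexBase p d)⁻¹) * ‖z‖ ^ 2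
        ≤ (1 + δ) * (1 - (rexBase p d)⁻¹) * ((1 + δ) * u) := by gcongr
      _ = ((1 + δ) * rexBound u p d) ^ 2 := by
        rw [rexBound_eq, mul_pow, sq_sqrt (by positivity)]
        ring
      _ < |inner ℝ (l j) z| ^ 2 :=
        pow_lt_pow_left₀ hj (mul_nonneg (by linarith) (rexBound_nonneg _ _ _)) two_ne_zero
      _ = (inner ℝ (l j) z) ^ 2 := sq_abs _
  refine (measureReal_mono hcaps).trans ((measureReal_union_le _ _).trans ?_)
  gcongr
  refine measureReal_iUnion_le_of_card_mul_le fun j => ?_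
  rw [Fintype.card_fin]
  exact hν.mul_rex_cap_le hp hd (hl j) hδ

theorem tendsto_log_natCast_atTop : Tendsto (fun n : ℕ => log n) atTop atTop :=
  tendsto_log_atTop.comp tendsto_natCast_atTop_atTop

theorem eventually_pos_of_tendsto_sq_norm_div {ν : (d : ℕ) → Measure (EuclideanSpace ℝ (Fin d))}
    [∀ d, IsProbabilityMeasure (ν d)] {u : ℕ → ℝ} {η : ℝ} (hη : η < 1)
    (hu : Tendsto (fun d => (ν d).real {z | η < |‖z‖ ^ 2 / u d - 1|}) atTop (𝓝 0)) :
    ∀ᶠ d in atTop, 0 < u d := by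
  filter_upwards [hu.eventually_lt_const one_pos] with d hd
  by_contra! hu_nonpos
  refine hd.ne ((congrArg _ (Set.eq_univ_of_forall fun z => ?_)).trans probReal_univ)
  have hdiv : ‖z‖ ^ 2 / u d ≤ 0 := div_nonpos_of_nonneg_of_nonpos (sq_nonneg _) hu_nonpos
  exact hη.trans_le (by rw [abs_of_nonpos] <;> linarith)

theorem exists_forall_measureReal_exists_rexBound_lt
    {ν : (d : ℕ) → Measure (EuclideanSpace ℝ (Fin d))} {u : ℕ → ℝ} (hν : ∀ d, IsRadialLaw (ν d))
    (hu : ∀ η : ℝ, 0 < η →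
      Tendsto (fun d => (ν d).real {z | η < |‖z‖ ^ 2 / u d - 1|}) atTop (𝓝 0))
    {δ ε : ℝ} (hδ : 0 < δ) (hε : 0 < ε) :
    ∃ N : ℕ, ∀ p d : ℕ, N ≤ p → N ≤ d →
      ∀ l : Fin p → EuclideanSpace ℝ (Fin d), (∀ j, ‖l j‖ = 1) →
        (ν d).real {z | ∃ j, (1 + δ) * rexBound (u d) p d < |inner ℝ (l j) z|} < ε := by
  have (d : ℕ) := (hν d).1
  have hcaps : Tendsto
      (fun p : ℕ => (1 + δ / 2 * log p)⁻¹ * (δ / (2 * (1 + δ))) ^ (-(1 / 2) : ℝ)) atTop (𝓝 0) := by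
    rw [← zero_mul ((δ / (2 * (1 + δ))) ^ (-(1 / 2) : ℝ))]
    exact (tendsto_inv_atTop_zero.comp (tendsto_atTop_add_const_left _ _
      (tendsto_log_natCast_atTop.const_mul_atTop (half_pos hδ)))).mul_const _
  obtain ⟨M, hM⟩ := eventually_atTop.1 ((eventually_ge_atTop 2).and
    (hcaps.eventually_lt_const (half_pos hε)))
  obtain ⟨N, hN⟩ := eventually_atTop.1 ((eventually_ge_atTop 3).and
    ((eventually_pos_of_tendsto_sq_norm_div one_half_lt_one (hu _ one_half_pos)).and
      ((hu δ hδ).eventually_lt_const (half_pos hε))))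
  refine ⟨max M N, fun p d hp hd l hl => ?_⟩
  obtain ⟨hp_two, hcaps_lt⟩ := hM p (le_of_max_le_left hp)
  obtain ⟨hd_three, hu_pos, hnorm_lt⟩ := hN d (le_of_max_le_right hd)
  linarith [(hν d).measureReal_exists_rexBound_lt_le hp_two hd_three hl hu_pos hδ]

end Elliptical

/-! ### High rank -/

section HighRank

open Real

variable {p d : ℕ}

theorem mul_rexBase_sub_one_le (hp : p ≠ 0) (hd : 2 ≤ d) (hpd : 2 * log p + 1 ≤ d) :
    d * (rexBase p d - 1) ≤ 8 * log p := by
  have hd' : (2 : ℝ) ≤ d := by exact_mod_cast hd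
  have hpos : (0 : ℝ) < d - 1 := by linarith
  have hx : 0 ≤ log p * (2 / ((d : ℝ) - 1)) := mul_nonneg (log_natCast_nonneg p) (by positivity)
  have hexp : rexBase p d - 1 ≤ 2 * (log p * (2 / (d - 1))) := by
    rw [rexBase, rpow_def_of_pos (by positivity)]
    have habs := abs_exp_sub_one_le (x := log p * (2 / ((d : ℝ) - 1))) (by
      rw [abs_of_nonneg hx, ← mul_div_assoc, div_le_one hpos]
      linarith)
    rw [abs_of_nonneg hx] at habs
    exact (le_abs_self _).trans habs
  calc d * (rexBase p d - 1) ≤ d * (2 * (log p * (2 / (d - 1)))) := by gcongr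
    _ ≤ (2 * (d - 1)) * (2 * (log p * (2 / (d - 1)))) := by
        gcongr
        linarith
    _ = 8 * log p := by
        field_simp
        ring

theorem sq_rexBound_mul_rexBase (hp : 2 ≤ p) (hd : 2 ≤ d) {u : ℝ} (hu : 0 ≤ u) :
    rexBound u p d ^ 2 * rexBase p d = u * (rexBase p d - 1) := by
  have hq := one_lt_rexBase hp hd
  rw [rexBound_eq, sq_sqrt (mul_nonneg hu (sub_nonneg.2 (inv_le_one_of_one_le₀ hq.le)))]
  field_simp

theorem mul_stdGaussian_lt_abs_inner_and_sq_norm_le_le (hp : 2 ≤ p) (hd : 2 ≤ d)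
    {l : EuclideanSpace ℝ (Fin d)} (hl : ‖l‖ = 1) {b : ℝ} (hb : 0 < b) (D : ℝ) :
    p * (stdGaussian (EuclideanSpace ℝ (Fin d))).real {z | b < |inner ℝ l z| ∧ ‖z‖ ^ 2 ≤ D} ≤
      exp ((rexBase p d - 1) / 2 * D - b ^ 2 * rexBase p d / 2) / √(b ^ 2 * rexBase p d) := by
  have hq := one_lt_rexBase hp hd
  have hbound := stdGaussian_lt_abs_inner_and_sq_norm_le hl hq.le hb D
  have hpow : p * rexBase p d ^ (-(d / 2) : ℝ) ≤ 1 := by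
    have hp_pos : (0 : ℝ) < p := by positivity
    rw [← le_inv_mul_iff₀ hp_pos, mul_one, ← rexBase_rpow p hd]
    exact rpow_le_rpow_of_exponent_le hq.le (by linarith)
  rw [finrank_euclideanSpace_fin] at hbound
  set q := rexBase p d
  have hsqrt : √(b ^ 2 * q) = √q * b := by
    rw [sqrt_mul (sq_nonneg b), sqrt_sq hb.le, mul_comm]
  have hsq : (√q * b) ^ 2 = b ^ 2 * q := by
    rw [mul_pow, sq_sqrt (by linarith), mul_comm]
  calc _ ≤ p * (exp ((q - 1) / 2 * D) *
        (q ^ (-(d / 2) : ℝ) * (exp (-(√q * b) ^ 2 / 2) / (√q * b)))) := by gcongr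
    _ = (p * q ^ (-(d / 2) : ℝ)) *
        (exp ((q - 1) / 2 * D) * exp (-(√q * b) ^ 2 / 2) / (√q * b)) := by ring
    _ ≤ 1 * (exp ((q - 1) / 2 * D) * exp (-(√q * b) ^ 2 / 2) / (√q * b)) := by gcongr
    _ = _ := by rw [one_mul, ← exp_add, hsq, hsqrt, neg_div, ← sub_eq_add_neg]

-- The Mills factor `1 / √(d (q - 1)) ≤ 1 / √(log p)` pays for the radius `√(d (1 + t))`, which
-- costs `exp (t d (q - 1) / 2) ≤ exp (4 t log p)`; this is what fixes the choice of `t`.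
theorem mul_stdGaussian_rexBound_lt_and_sq_norm_le_le (hd : 2 ≤ d) (hlog : 1 ≤ log p)
    (hpd : 2 * log p + 1 ≤ d) {l : EuclideanSpace ℝ (Fin d)} (hl : ‖l‖ = 1) :
    p * (stdGaussian (EuclideanSpace ℝ (Fin d))).real {z | rexBound d p d < |inner ℝ l z| ∧
      ‖z‖ ^ 2 ≤ d * (1 + log (log p) / (16 * log p))} ≤ exp (-(log (log p) / 4)) := by
  have hp : 2 ≤ p := by
    by_contra! h
    interval_cases p <;> norm_num at hlog
  have hlog_pos : 0 < log p := by linarith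
  have hq := one_lt_rexBase hp hd
  have hlower : log p ≤ d * (rexBase p d - 1) := by
    linarith [two_mul_log_le_mul_rexBase_sub_one (by lia : p ≠ 0) hd]
  have hupper := mul_rexBase_sub_one_le (by lia : p ≠ 0) hd hpd
  have hb_sq := sq_rexBound_mul_rexBase hp hd (Nat.cast_nonneg (α := ℝ) d)
  have hb : 0 < rexBound d p d := (rexBound_nonneg _ _ _).lt_of_ne fun h => by
    rw [← h] at hb_sq
    linarith
  set q := rexBase p d
  set t := log (log p) / (16 * log p) with ht
  have ht_nonneg : 0 ≤ t := div_nonneg (log_nonneg hlog) (by positivity)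
  have hexponent : (q - 1) / 2 * (d * (1 + t)) - rexBound d p d ^ 2 * q / 2 ≤ log (log p) / 4 :=
    calc _ = t * (d * (q - 1)) / 2 := by rw [hb_sq]; ring
      _ ≤ t * (8 * log p) / 2 := by gcongr
      _ = log (log p) / 4 := by rw [ht]; field_simp; ring
  have hsqrt : exp (log (log p) / 2) ≤ √(rexBound d p d ^ 2 * q) := by
    rw [exp_half, exp_log hlog_pos, hb_sq]
    exact sqrt_le_sqrt hlower
  calc _ ≤ exp ((q - 1) / 2 * (d * (1 + t)) - rexBound d p d ^ 2 * q / 2) /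
        √(rexBound d p d ^ 2 * q) :=
        mul_stdGaussian_lt_abs_inner_and_sq_norm_le_le hp hd hl hb _
    _ ≤ exp (log (log p) / 4) / exp (log (log p) / 2) := by gcongr
    _ = exp (-(log (log p) / 4)) := by rw [← exp_sub]; congr 1; ring

theorem stdGaussian_exists_rexBound_lt_le (hd : 2 ≤ d) (hlog : 1 ≤ log p)
    (hpd : 2 * log p + 1 ≤ d) {l : Fin p → EuclideanSpace ℝ (Fin d)} (hl : ∀ j, ‖l j‖ = 1) :
    (stdGaussian (EuclideanSpace ℝ (Fin d))).real {z | ∃ j, rexBound d p d < |inner ℝ (l j) z|} ≤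
      exp (-(log (log p) ^ 2 * d / log p ^ 2 / 2048)) + exp (-(log (log p) / 4)) := by
  have : Nonempty (Fin p) := ⟨⟨0, Nat.pos_of_ne_zero (by rintro rfl; norm_num at hlog)⟩⟩
  set t := log (log p) / (16 * log p) with ht
  have ht_nonneg : 0 ≤ t := div_nonneg (log_nonneg hlog) (by positivity)
  have ht_half : t ≤ 1 / 2 := by
    rw [ht, div_le_iff₀ (by positivity)]
    linarith [log_le_self (by linarith : 0 ≤ log p)]
  have hcover : {z : EuclideanSpace ℝ (Fin d) | ∃ j, rexBound d p d < |inner ℝ (l j) z|} ⊆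
      {z | d * (1 + t) ≤ ‖z‖ ^ 2} ∪
        ⋃ j, {z | rexBound d p d < |inner ℝ (l j) z| ∧ ‖z‖ ^ 2 ≤ d * (1 + t)} := by
    rintro z ⟨j, hj⟩
    exact (le_total (d * (1 + t)) (‖z‖ ^ 2)).imp_right fun h => Set.mem_iUnion.2 ⟨j, hj, h⟩
  have hnorm := stdGaussian_le_sq_norm_le (E := EuclideanSpace ℝ (Fin d)) ht_nonneg ht_half
  have ht_sq : (d : ℝ) * t ^ 2 / 8 = log (log p) ^ 2 * d / log p ^ 2 / 2048 := by
    rw [ht]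
    field_simp
    ring
  rw [finrank_euclideanSpace_fin, ht_sq] at hnorm
  refine (measureReal_mono hcover).trans ((measureReal_union_le _ _).trans (add_le_add hnorm ?_))
  refine measureReal_iUnion_le_of_card_mul_le fun j => ?_
  rw [Fintype.card_fin]
  exact mul_stdGaussian_rexBound_lt_and_sq_norm_le_le hd hlog hpd (hl j)

theorem eventually_two_mul_log_add_one_le {d : ℕ → ℕ}
    (hd : Tendsto (fun p : ℕ => log (log p) ^ 2 * d p / log p ^ 2) atTop atTop) :
    ∀ᶠ p : ℕ in atTop, 2 * log p + 1 ≤ d p := by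
  have hloglog : ∀ᶠ p : ℕ in atTop, log (log p) ^ 2 ≤ 1 / 3 * log p := by
    have hbound := (isLittleO_pow_log_id_atTop (n := 2)).bound (by norm_num : (0 : ℝ) < 1 / 3)
    filter_upwards [tendsto_log_natCast_atTop.eventually hbound] with p hp
    rwa [norm_of_nonneg (sq_nonneg _), id, norm_of_nonneg (log_natCast_nonneg p)] at hp
  filter_upwards [hloglog, tendsto_log_natCast_atTop.eventually_ge_atTop 1,
    hd.eventually_ge_atTop 1] with p hloglog hlog hgrowth
  rw [one_le_div (by positivity)] at hgrowth
  have hsq : log p * log p ≤ log p * (1 / 3 * d p) :=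
    calc log p * log p ≤ log (log p) ^ 2 * d p := by rwa [← sq]
      _ ≤ 1 / 3 * log p * d p := by gcongr
      _ = log p * (1 / 3 * d p) := by ring
  linarith [le_of_mul_le_mul_left hsq (by linarith)]

theorem exists_forall_stdGaussian_exists_rexBound_lt {d : ℕ → ℕ}
    (hd : Tendsto (fun p : ℕ => log (log p) ^ 2 * d p / log p ^ 2) atTop atTop) {ε : ℝ}
    (hε : 0 < ε) :
    ∃ N : ℕ, ∀ p : ℕ, N ≤ p → ∀ l : Fin p → EuclideanSpace ℝ (Fin (d p)), (∀ j, ‖l j‖ = 1) →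
      (stdGaussian (EuclideanSpace ℝ (Fin (d p)))).real
        {z | ∃ j, rexBound (d p) p (d p) < |inner ℝ (l j) z|} < ε := by
  have hnorm := tendsto_exp_neg_atTop_nhds_zero.comp
    (hd.atTop_div_const (by norm_num : (0 : ℝ) < 2048))
  have hcaps := tendsto_exp_neg_atTop_nhds_zero.comp
    ((tendsto_log_atTop.comp tendsto_log_natCast_atTop).atTop_div_const (by norm_num : (0 : ℝ) < 4))
  obtain ⟨N, hN⟩ := eventually_atTop.1 ((eventually_two_mul_log_add_one_le hd).and
    ((tendsto_log_natCast_atTop.eventually_ge_atTop 1).and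
      ((hnorm.eventually_lt_const (half_pos hε)).and (hcaps.eventually_lt_const (half_pos hε)))))
  refine ⟨N, fun p hp l hl => ?_⟩
  obtain ⟨hpd, hlog, hnorm_lt, hcaps_lt⟩ := hN p hp
  have hd_two : 2 ≤ d p := by
    have : (2 : ℝ) ≤ d p := by linarith
    exact_mod_cast this
  refine (stdGaussian_exists_rexBound_lt_le hd_two hlog hpd hl).trans_lt ?_
  simp only [Function.comp_apply] at hnorm_lt hcaps_lt
  linarith

end HighRank

section Reduction

open Real

theorem tendsto_stdGaussian_sq_norm_div {η : ℝ} (hη : 0 < η) :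
    Tendsto (fun d : ℕ => (stdGaussian (EuclideanSpace ℝ (Fin d))).real
      {z | η < |‖z‖ ^ 2 / d - 1|}) atTop (𝓝 0) := by
  set t := min η (1 / 2)
  have ht_pos : 0 < t := lt_min hη one_half_pos
  have hlim : Tendsto (fun d : ℕ => 2 * exp (-(d * t ^ 2 / 8))) atTop (𝓝 0) := by
    rw [← mul_zero (2 : ℝ)]
    exact (tendsto_exp_neg_atTop_nhds_zero.comp ((tendsto_natCast_atTop_atTop.atTop_mul_const
      (pow_pos ht_pos 2)).atTop_div_const (by norm_num))).const_mul 2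
  refine squeeze_zero' (.of_forall fun d => measureReal_nonneg) ?_ hlim
  filter_upwards [eventually_gt_atTop 0] with d hd
  have hd' : (0 : ℝ) < d := by exact_mod_cast hd
  have hcover : {z : EuclideanSpace ℝ (Fin d) | η < |‖z‖ ^ 2 / d - 1|} ⊆
      {z | d * (1 + t) ≤ ‖z‖ ^ 2} ∪ {z | ‖z‖ ^ 2 ≤ d * (1 - t)} := fun z hz => by
    have hdiv : t < |‖z‖ ^ 2 / d - 1| := (min_le_left _ _).trans_lt hz
    refine (lt_abs.1 hdiv).imp (fun h => ?_) fun h => ?_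
    · exact (le_div_iff₀' hd').1 (by linarith)
    · exact (div_le_iff₀' hd').1 (by linarith)
  have hupper := stdGaussian_le_sq_norm_le (E := EuclideanSpace ℝ (Fin d)) ht_pos.le
    (min_le_right _ _)
  have hlower := stdGaussian_sq_norm_le_le (E := EuclideanSpace ℝ (Fin d)) ht_pos.le
    (min_le_right _ _)
  rw [finrank_euclideanSpace_fin] at hupper hlower
  linarith [(measureReal_mono hcover).trans (measureReal_union_le
    (μ := stdGaussian (EuclideanSpace ℝ (Fin d))) _ _)]

theorem IsCorrelationMatrix.exists_hasLaw_innerVec {p d : ℕ} {S : Matrix (Fin p) (Fin p) ℝ}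
    (hS : IsCorrelationMatrix S) (hrank : S.rank ≤ d) {Ω : Type*} [MeasurableSpace Ω]
    {P : Measure Ω} {X : Ω → EuclideanSpace ℝ (Fin p)}
    (hX : HasLaw X (multivariateGaussian 0 S) P) :
    ∃ l : Fin p → EuclideanSpace ℝ (Fin d), (∀ j, ‖l j‖ = 1) ∧
      HasLaw X ((stdGaussian _).map (innerVec l)) P := by
  obtain ⟨l, hl⟩ := exists_gram_eq (E := EuclideanSpace ℝ (Fin d)) hS.1
    (by rwa [finrank_euclideanSpace_fin])
  exact ⟨l, hS.norm_eq_one_of_gram_eq hl, by rwa [map_innerVec_stdGaussian, hl]⟩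

theorem IsEllipticalVector.exists_hasLaw_innerVec {p d : ℕ} {S : Matrix (Fin p) (Fin p) ℝ}
    (hS : IsCorrelationMatrix S) {ν : Measure (EuclideanSpace ℝ (Fin d))} {Ω : Type*}
    [MeasurableSpace Ω] {P : Measure Ω} {X : Ω → EuclideanSpace ℝ (Fin p)}
    (hX : IsEllipticalVector ν S X P) :
    ∃ l : Fin p → EuclideanSpace ℝ (Fin d), (∀ j, ‖l j‖ = 1) ∧
      HasLaw X (ν.map (innerVec l)) P := by
  obtain ⟨-, L, hL, hlaw⟩ := hX
  refine ⟨fun j => WithLp.toLp 2 (L.col j), hS.norm_eq_one_of_gram_eq ?_, ?_⟩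
  · rw [gram_toLp_col, hL]
  · rwa [funext (innerVec_toLp_col L)]

end Reduction

theorem theorem4_general :
    (∀ (ν : (d : ℕ) → Measure (EuclideanSpace ℝ (Fin d))) (u : ℕ → ℝ), (∀ d, IsRadialLaw (ν d)) →
      (∀ η : ℝ, 0 < η →
        Tendsto (fun d => (ν d).real {z | η < |‖z‖ ^ 2 / u d - 1|}) atTop (𝓝 0)) →
      ∀ δ : ℝ, 0 < δ → ∀ ε : ℝ, 0 < ε → ∃ N : ℕ, ∀ p d : ℕ, N ≤ p → N ≤ d →
        ∀ l : Fin p → EuclideanSpace ℝ (Fin d), (∀ j, ‖l j‖ = 1) →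
        ∀ (Ω : Type*) [MeasurableSpace Ω] (P : Measure Ω) (X : Ω → EuclideanSpace ℝ (Fin p)),
          HasLaw X ((ν d).map (innerVec l)) P →
          P.real {ω | maxNorm (X ω) / rexBound (u d) p d > 1 + δ} < ε) ∧
    (∀ δ : ℝ, 0 < δ → ∀ ε : ℝ, 0 < ε → ∃ N : ℕ, ∀ p d : ℕ, N ≤ p → N ≤ d →
        ∀ S : Matrix (Fin p) (Fin p) ℝ, IsCorrelationMatrix S → S.rank ≤ d →
        ∀ (Ω : Type*) [MeasurableSpace Ω] (P : Measure Ω) (X : Ω → EuclideanSpace ℝ (Fin p)),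
          HasLaw X (multivariateGaussian 0 S) P →
          P.real {ω | maxNorm (X ω) / rexBound d p d > 1 + δ} < ε) ∧
    (∀ d : ℕ → ℕ,
      Tendsto (fun p : ℕ => (Real.log (Real.log p)) ^ 2 * (d p : ℝ) / (Real.log p) ^ 2)
        atTop atTop →
      ∀ ε : ℝ, 0 < ε → ∃ N : ℕ, ∀ p : ℕ, N ≤ p →
        ∀ S : Matrix (Fin p) (Fin p) ℝ, IsCorrelationMatrix S → S.rank ≤ d p →
        ∀ (Ω : Type*) [MeasurableSpace Ω] (P : Measure Ω) (X : Ω → EuclideanSpace ℝ (Fin p)),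
          HasLaw X (multivariateGaussian 0 S) P →
          1 - ε < P.real {ω | maxNorm (X ω) / rexBound (d p) p (d p) ≤ 1}) := by
  refine ⟨fun ν u hν hu δ hδ ε hε => ?_, fun δ hδ ε hε => ?_, fun d hd ε hε => ?_⟩
  · have (d : ℕ) := (hν d).1
    obtain ⟨N, hN⟩ := exists_forall_measureReal_exists_rexBound_lt hν hu hδ hε
    exact ⟨N, fun p d hp hd l hl Ω _ P X hX =>
      (measureReal_lt_maxNorm_div_le hX (by positivity) (rexBound_nonneg _ _ _)).trans_lt
        (hN p d hp hd l hl)⟩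
  · obtain ⟨N, hN⟩ := exists_forall_measureReal_exists_rexBound_lt
      (fun d => isRadialLaw_stdGaussian) (fun η hη => tendsto_stdGaussian_sq_norm_div hη) hδ hε
    refine ⟨N, fun p d hp hd S hS hrank Ω _ P X hX => ?_⟩
    obtain ⟨l, hl, hlaw⟩ := hS.exists_hasLaw_innerVec hrank hX
    exact (measureReal_lt_maxNorm_div_le hlaw (by positivity) (rexBound_nonneg _ _ _)).trans_lt
      (hN p d hp hd l hl)
  · obtain ⟨N, hN⟩ := exists_forall_stdGaussian_exists_rexBound_lt hd hε
    refine ⟨N, fun p hp S hS hrank Ω _ P X hX => ?_⟩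
    obtain ⟨l, hl, hlaw⟩ := hS.exists_hasLaw_innerVec hrank hX
    linarith [hN p hp l hl,
      one_sub_le_measureReal_maxNorm_div_le_one hlaw (rexBound_nonneg (d p) p (d p))]

theorem theorem4 :
    -- Elliptical vectors: `ν d` is the law of `Z_d ∼ EC_d(0, I)`, and `‖Z_d‖² / u d → 1` in
    -- probability. The double limit is uniform over all correlation matrices of rank `d`.
    (∀ (ν : (d : ℕ) → Measure (EuclideanSpace ℝ (Fin d))) (u : ℕ → ℝ),
      (∀ d, IsEllipticalLaw 0 1 (ν d)) →
      (∀ η : ℝ, 0 < η →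
        Tendsto (fun d => (ν d).real {z | η < |‖z‖ ^ 2 / u d - 1|}) atTop (𝓝 0)) →
      ∀ δ : ℝ, 0 < δ → ∀ ε : ℝ, 0 < ε → ∃ N : ℕ, ∀ p d : ℕ, N ≤ p → N ≤ d →
        ∀ S : Matrix (Fin p) (Fin p) ℝ, IsCorrelationMatrix S → S.rank = d →
        ∀ (Ω : Type*) [MeasurableSpace Ω] (P : Measure Ω) [IsProbabilityMeasure P]
          (X : Ω → EuclideanSpace ℝ (Fin p)), IsEllipticalVector (ν d) S X P →
          P.real {ω | maxNorm (X ω) / rexBound (u d) p d > 1 + δ} < ε) ∧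
    -- Gaussian vectors, with `u_d = d`.
    (∀ δ : ℝ, 0 < δ → ∀ ε : ℝ, 0 < ε → ∃ N : ℕ, ∀ p d : ℕ, N ≤ p → N ≤ d →
        ∀ S : Matrix (Fin p) (Fin p) ℝ, IsCorrelationMatrix S → S.rank = d →
        ∀ (Ω : Type*) [MeasurableSpace Ω] (P : Measure Ω) [IsProbabilityMeasure P]
          (X : Ω → EuclideanSpace ℝ (Fin p)), HasLaw X (multivariateGaussian 0 S) P →
          P.real {ω | maxNorm (X ω) / rexBound d p d > 1 + δ} < ε) ∧
    -- Gaussian vectors of high rank `d = d(p)`.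
    (∀ d : ℕ → ℕ,
      Tendsto (fun p : ℕ => (Real.log (Real.log p)) ^ 2 * (d p : ℝ) / (Real.log p) ^ 2)
        atTop atTop →
      ∀ ε : ℝ, 0 < ε → ∃ N : ℕ, ∀ p : ℕ, N ≤ p →
        ∀ S : Matrix (Fin p) (Fin p) ℝ, IsCorrelationMatrix S → S.rank = d p →
        ∀ (Ω : Type*) [MeasurableSpace Ω] (P : Measure Ω) [IsProbabilityMeasure P]
          (X : Ω → EuclideanSpace ℝ (Fin p)), HasLaw X (multivariateGaussian 0 S) P →
          1 - ε < P.real {ω | maxNorm (X ω) / rexBound (d p) p (d p) ≤ 1}) := by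
  obtain ⟨helliptical, hgaussian, hrank⟩ := theorem4_general
  refine ⟨fun ν u hν hu δ hδ ε hε => ?_, fun δ hδ ε hε => ?_, fun d hd ε hε => ?_⟩
  · obtain ⟨N, hN⟩ := helliptical ν u (fun d => (hν d).isRadialLaw) hu δ hδ ε hε
    refine ⟨N, fun p d hp hd S hS _ Ω _ P _ X hX => ?_⟩
    obtain ⟨l, hl, hlaw⟩ := hX.exists_hasLaw_innerVec hS
    exact hN p d hp hd l hl Ω P X hlaw
  · exact (hgaussian δ hδ ε hε).imp fun N hN p d hp hd S hS hS_rank Ω _ P _ X =>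
      hN p d hp hd S hS hS_rank.le Ω P X
  · exact (hrank d hd ε hε).imp fun N hN p hp S hS hS_rank Ω _ P _ X =>
      hN p hp S hS hS_rank.le Ω P X
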